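/- **Setting.** Let $L\ge 1$ and let $n_L>n_{L-1}>\cdots>n_0\ge 1$ be integers. Let $A_L\in\mathbb{R}^{n_L\times n_L}$ be symmetric positive definite (SPD). For $1\le k\le L$ let $P_k\in\mathbb{R}^{n_k\times n_{k-1}}$ have rank $n_{k-1}$, put $A_{k-1}=P_k^TA_kP_k$, and let $M_k\in\mathbb{R}^{n_k\times n_k}$ be nonsingular with $M_k+M_k^T-A_k$ SPD. Let $\hat A_0\in\mathbb{R}^{n_0\times n_0}$ be such that $\hat A_0-A_0$ is symmetric positive semidefinite. Put $\widetilde M_k=M_k^T(M_k+M_k^T-A_k)^{-1}M_k$, and let $\|\cdot\|_{A_k}$ be the matrix norm induced by the vector norm $\|v\|_{A_k}=(v^TA_kv)^{1/2}$. The error propagation matrix of the exact two-grid method at level $k$ is $$E_{\rm TG}^{(k)}=(I-M_k^{-T}A_k)(I-P_kA_{k-1}^{-1}P_k^TA_k)(I-M_k^{-1}A_k).$$ The error propagation matrix of the multigrid method with cycle index $\gamma\ge 1$ (where the coarsest system is solved with $\hat A_0$ in place of $A_0$) is given by $$E_{\rm IMG}^{(1)}=(I-M_1^{-T}A_1)(I-P_1\hat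 A_0^{-1}P_1^TA_1)(I-M_1^{-1}A_1),$$ $$E_{\rm IMG}^{(k)}=(I-M_k^{-T}A_k)\Big[I-P_k\Big(I-\big(E_{\rm IMG}^{(k-1)}\big)^{\gamma}\Big)A_{k-1}^{-1}P_k^TA_k\Big](I-M_k^{-1}A_k)\qquad(2\le k\le L).$$ Put $\sigma_{\rm TG}^{(k)}=\|E_{\rm TG}^{(k)}\|_{A_k}$, $\sigma_{\rm IMG}^{(k)}=\|E_{\rm IMG}^{(k)}\|_{A_k}$, and $$\sigma_L=\max_{1\le k\le L}\sigma_{\rm TG}^{(k)},\qquad \tau_L=\max_{1\le k\le L}\lambda_{\max}\big((P_k^T\widetilde M_kP_k)^{-1}A_{k-1}\big),\qquad \varepsilon_L=\min_{1\le k\le L}\lambda_{\min}(\widetilde M_k^{-1}A_k).$$ Assume $0<\sigma_L<1-\varepsilon_L$. For $\gamma\ge 1$ consider the equation $$\frac{\sigma_L\varepsilon_L(1-x^\gamma)+\tau_L(1-\varepsilon_L)(1-\sigma_L)x^\gamma}{\varepsilon_L(1-x^\gamma)+\tau_L(1-\sigma_L)x^\gamma}-x=0,\qquad \sigma_L<x<1-\varepsilon_L.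 \tag{$*_\gamma$}$$ **Statement.** Let $$\mu_L=1+\sigma_L-\frac{\tau_L(1-\varepsilon_L)(1-\sigma_L)}{\varepsilon_L},\qquad x_1=\frac{2\sigma_L}{\mu_L+\sqrt{\mu_L^2-4\sigma_L\big(1-\frac{\tau_L}{\varepsilon_L}(1-\sigma_L)\big)}},$$ $$\hat x_2=\begin{cases}\dfrac{2\sigma_L}{1+\sqrt{1-4\sigma_L(1-\sigma_L-\varepsilon_L)}}&\text{if }\tau_L(1-\sigma_L)=\varepsilon_L,\\[2ex]\dfrac{\sigma_L\varepsilon_L(1-x_1^2)+\tau_L(1-\varepsilon_L)(1-\sigma_L)x_1^2}{\varepsilon_L(1-x_1^2)+\tau_L(1-\sigma_L)x_1^2}&\text{otherwise.}\end{cases}$$ Then $x_1$ is the unique solution of $(*_1)$. Moreover, let $\gamma\in\{1,2\}$ and let $x_\gamma$ denote $x_1$ if $\gamma=1$ and any solution of $(*_2)$ if $\gamma=2$. If $$\lambda\big((P_1^T\widetilde M_1P_1)^{-1}(\hat A_0-A_0)\big)\subset\Big[0,\ \frac{\varepsilon_L(x_\gamma-\sigma_L)}{(1-\sigma_L)(1-\varepsilon_L-x_\gamma)}\Big],$$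 then, for the multigrid method with cycle index $\gamma$ and for every $k=1,\dots,L$, $$\sigma_{\rm IMG}^{(k)}\le\begin{cases}x_1&\text{if }\gamma=1,\\ \hat x_2&\text{if }\gamma=2.\end{cases}$$ -/

import Mathlib

open scoped Matrix

noncomputable section

/-- Largest eigenvalue of a real square matrix with real spectrum. -/
def lambdaMax {m : ℕ} (B : Matrix (Fin m) (Fin m) ℝ) : ℝ := sSup (spectrum ℝ B)

/-- Smallest eigenvalue of a real square matrix with real spectrum. -/
def lambdaMin {m : ℕ} (B : Matrix (Fin m) (Fin m) ℝ) : ℝ := sInf (spectrum ℝ B)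

/-- The energy norm `‖v‖_A = ⟨A v, v⟩ ^ (1/2)` of a vector. -/
def energyNorm {m : ℕ} (A : Matrix (Fin m) (Fin m) ℝ) (v : Fin m → ℝ) : ℝ :=
  Real.sqrt ((A *ᵥ v) ⬝ᵥ v)

/-- The energy norm `‖B‖_A = max_{v ≠ 0} ‖B v‖_A / ‖v‖_A` of a matrix. -/
def energyOpNorm {m : ℕ} (A B : Matrix (Fin m) (Fin m) ℝ) : ℝ :=
  ⨆ v : {v : Fin m → ℝ // v ≠ 0}, energyNorm A (B *ᵥ v.1) / energyNorm A v.1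

/-- The symmetrized smoother `M̃ = Mᵀ (M + Mᵀ - A)⁻¹ M`. -/
def symmSmoother {m : ℕ} (A M : Matrix (Fin m) (Fin m) ℝ) : Matrix (Fin m) (Fin m) ℝ :=
  Mᵀ * (M + Mᵀ - A)⁻¹ * M

/-- One step of the symmetric two-grid scheme for `A u = f`: presmoothing with `M`, restriction
with `Pᵀ`, application of a coarse solver, prolongation with `P`, postsmoothing with `Mᵀ`. -/
def twoGridStep {m c : ℕ} (A M : Matrix (Fin m) (Fin m) ℝ) (P : Matrix (Fin m) (Fin c) ℝ)
    (solve : (Fin c → ℝ) → (Fin c → ℝ)) (f u₀ : Fin m → ℝ) : Fin m → ℝ :=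
  let u₁ := u₀ + M⁻¹ *ᵥ (f - A *ᵥ u₀)
  let r := Pᵀ *ᵥ (f - A *ᵥ u₁)
  let u₂ := u₁ + P *ᵥ solve r
  u₂ + Mᵀ⁻¹ *ᵥ (f - A *ᵥ u₂)

/-- The error propagation matrix `(I - M⁻ᵀ A) (I - P C Pᵀ A) (I - M⁻¹ A)` of a symmetric two-grid
scheme in which the coarse residual `r` is turned into the coarse correction `C r`. -/
def twoGridError {m c : ℕ} (A M : Matrix (Fin m) (Fin m) ℝ) (P : Matrix (Fin m) (Fin c) ℝ)
    (C : Matrix (Fin c) (Fin c) ℝ) : Matrix (Fin m) (Fin m) ℝ :=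
  (1 - Mᵀ⁻¹ * A) * (1 - P * C * Pᵀ * A) * (1 - M⁻¹ * A)

/-- The data of a multigrid method on the levels `0, …, L` (`0` coarsest, `L` finest).
The families are indexed by all of `ℕ` for convenience only: nothing is required of, and nothing
below uses, the entries that belong to levels above `L`.
`P k` is the prolongation from level `k` to level `k + 1`, and `M k` is the smoother of
level `k + 1`. -/
structure MultigridHierarchy (L : ℕ) where
  /-- number of unknowns at each level -/
  n : ℕ → ℕ
  /-- system matrices -/
  A : (k : ℕ) → Matrix (Fin (n k)) (Fin (n k)) ℝ
  /-- prolongations, from level `k` to level `k + 1` -/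
  P : (k : ℕ) → Matrix (Fin (n (k + 1))) (Fin (n k)) ℝ
  /-- smoothers, at level `k + 1` -/
  M : (k : ℕ) → Matrix (Fin (n (k + 1))) (Fin (n (k + 1))) ℝ
  /-- the matrix that replaces `A 0` in the solve on the coarsest level -/
  Ahat : Matrix (Fin (n 0)) (Fin (n 0)) ℝ
  L_pos : 0 < L
  n_pos : 0 < n 0
  n_lt : ∀ k < L, n k < n (k + 1)
  rank_P : ∀ k < L, (P k).rank = n k
  A_posDef : (A L).PosDef
  /-- the coarse matrices are the Galerkin matrices -/
  A_galerkin : ∀ k < L, A k = (P k)ᵀ * A (k + 1) * P k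
  Ahat_sub : (Ahat - A 0).PosSemidef
  M_unit : ∀ k < L, IsUnit (M k)
  M_posDef : ∀ k < L, (M k + (M k)ᵀ - A (k + 1)).PosDef

namespace MultigridHierarchy

variable {L : ℕ} (H : MultigridHierarchy L)

/-- The multigrid algorithm with cycle index `γ` at level `k + 1`, applied to
`A (k + 1) u = f` with initial guess `u₀`. On level `1` the coarse correction is `Ahat⁻¹ r`;
above, it is the result of `γ` multigrid iterations on the next coarser level,
started from zero. -/
def cycle (γ : ℕ) : (k : ℕ) → (f u₀ : Fin (H.n (k + 1)) → ℝ) → (Fin (H.n (k + 1)) → ℝ)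
  | 0, f, u₀ => twoGridStep (H.A 1) (H.M 0) (H.P 0) (fun r => H.Ahat⁻¹ *ᵥ r) f u₀
  | k + 1, f, u₀ =>
      twoGridStep (H.A (k + 2)) (H.M (k + 1)) (H.P (k + 1)) (fun r => (cycle γ k r)^[γ] 0) f u₀

/-- The error propagation matrix of the multigrid algorithm with cycle index `γ`
at level `k + 1`. -/
def errorIMG (γ : ℕ) : (k : ℕ) → Matrix (Fin (H.n (k + 1))) (Fin (H.n (k + 1))) ℝ
  | 0 => twoGridError (H.A 1) (H.M 0) (H.P 0) H.Ahat⁻¹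
  | k + 1 => twoGridError (H.A (k + 2)) (H.M (k + 1)) (H.P (k + 1))
      ((1 - errorIMG γ k ^ γ) * (H.A (k + 1))⁻¹)

/-- The error propagation matrix of the exact two-grid method at level `k + 1`. -/
def errorTG (k : ℕ) : Matrix (Fin (H.n (k + 1))) (Fin (H.n (k + 1))) ℝ :=
  twoGridError (H.A (k + 1)) (H.M k) (H.P k) (H.A k)⁻¹

/-- Convergence factor of the multigrid method at level `k + 1`. -/
def sigmaIMG (γ k : ℕ) : ℝ := energyOpNorm (H.A (k + 1)) (H.errorIMG γ k)

/-- Convergence factor of the exact two-grid method at level `k + 1`. -/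
def sigmaTG (k : ℕ) : ℝ := energyOpNorm (H.A (k + 1)) (H.errorTG k)

/-- The symmetrized smoother at level `k + 1`. -/
def Mtilde (k : ℕ) : Matrix (Fin (H.n (k + 1))) (Fin (H.n (k + 1))) ℝ :=
  symmSmoother (H.A (k + 1)) (H.M k)

/-- `σ_L`, the maximum over the levels `1, …, L` of the exact two-grid convergence factor. -/
def sigma : ℝ := ⨆ k : Fin L, H.sigmaTG k

/-- `τ_L`, the maximum over the levels `1, …, L` of `λ_max ((Pᵀ M̃ P)⁻¹ A_{k-1})`. -/
def tau : ℝ := ⨆ k : Fin L, lambdaMax (((H.P k)ᵀ * H.Mtilde k * H.P k)⁻¹ * H.A k)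

/-- `ε_L`, the minimum over the levels `1, …, L` of `λ_min (M̃⁻¹ A)`. -/
def eps : ℝ := ⨅ k : Fin L, lambdaMin ((H.Mtilde k)⁻¹ * H.A (k + 1))

/-- The condition on the coarsest-level solver, with parameter `x`. -/
def CoarseCondition (x : ℝ) : Prop :=
  spectrum ℝ (((H.P 0)ᵀ * H.Mtilde 0 * H.P 0)⁻¹ * (H.Ahat - H.A 0)) ⊆
    Set.Icc 0 (H.eps * (x - H.sigma) / ((1 - H.sigma) * (1 - H.eps - x)))

end MultigridHierarchy

/-- The right-hand side of the recursive bound for cycle index `γ`. -/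
def mgBound (σ τ ε : ℝ) (γ : ℕ) (x : ℝ) : ℝ :=
  (σ * ε * (1 - x ^ γ) + τ * (1 - ε) * (1 - σ) * x ^ γ) /
    (ε * (1 - x ^ γ) + τ * (1 - σ) * x ^ γ)

/-- `x` is a root in `(σ, 1 - ε)` of the fixed-point equation for cycle index `γ`. -/
def IsMGRoot (σ τ ε : ℝ) (γ : ℕ) (x : ℝ) : Prop :=
  x ∈ Set.Ioo σ (1 - ε) ∧ mgBound σ τ ε γ x - x = 0

/-- `μ_L` -/
def muL (σ τ ε : ℝ) : ℝ := 1 + σ - τ * (1 - ε) * (1 - σ) / ε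

/-- The closed-form V-cycle bound. -/
def xOne (σ τ ε : ℝ) : ℝ :=
  2 * σ / (muL σ τ ε + Real.sqrt (muL σ τ ε ^ 2 - 4 * σ * (1 - τ / ε * (1 - σ))))

open Classical in
/-- The closed-form W-cycle bound. -/
def xHatTwo (σ τ ε : ℝ) : ℝ :=
  if τ * (1 - σ) = ε then
    2 * σ / (1 + Real.sqrt (1 - 4 * σ * (1 - σ - ε)))
  else
    (σ * ε * (1 - xOne σ τ ε ^ 2) + τ * (1 - ε) * (1 - σ) * xOne σ τ ε ^ 2) /
      (ε * (1 - xOne σ τ ε ^ 2) + τ * (1 - σ) * xOne σ τ ε ^ 2)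

theorem twoGridStep_error {m c : ℕ} (A M : Matrix (Fin m) (Fin m) ℝ)
    (P : Matrix (Fin m) (Fin c) ℝ) (C : Matrix (Fin c) (Fin c) ℝ)
    (solve : (Fin c → ℝ) → (Fin c → ℝ)) (hs : ∀ r, solve r = C *ᵥ r) (u u₀ : Fin m → ℝ) :
    u - twoGridStep A M P solve (A *ᵥ u) u₀ = twoGridError A M P C *ᵥ (u - u₀) := by
  have h₁ : u - (u₀ + M⁻¹ *ᵥ (A *ᵥ u - A *ᵥ u₀)) = (1 - M⁻¹ * A) *ᵥ (u - u₀) := by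
    rw [← Matrix.mulVec_sub, Matrix.sub_mulVec, Matrix.one_mulVec, ← Matrix.mulVec_mulVec]
    abel
  have h₂ : ∀ w, u - (w + P *ᵥ solve (Pᵀ *ᵥ (A *ᵥ u - A *ᵥ w))) =
      (1 - P * C * Pᵀ * A) *ᵥ (u - w) := by
    intro w
    rw [hs, ← Matrix.mulVec_sub, Matrix.sub_mulVec, Matrix.one_mulVec,
      ← Matrix.mulVec_mulVec, ← Matrix.mulVec_mulVec, ← Matrix.mulVec_mulVec]
    abel
  have h₃ : ∀ w, u - (w + Mᵀ⁻¹ *ᵥ (A *ᵥ u - A *ᵥ w)) = (1 - Mᵀ⁻¹ * A) *ᵥ (u - w) := by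
    intro w
    rw [← Matrix.mulVec_sub, Matrix.sub_mulVec, Matrix.one_mulVec, ← Matrix.mulVec_mulVec]
    abel
  simp only [twoGridStep, twoGridError]
  rw [h₃, h₂, h₁, Matrix.mulVec_mulVec, Matrix.mulVec_mulVec]

namespace MultigridHierarchy

variable {L : ℕ} (H : MultigridHierarchy L)

theorem posDef_A : ∀ k ≤ L, (H.A k).PosDef := by
  intro k hk
  induction hk using Nat.decreasingInduction with
  | self => exact H.A_posDef
  | of_succ k hk ih =>
    rw [H.A_galerkin k hk]
    have hinj : Function.Injective (H.P k).mulVec := by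
      rw [Matrix.mulVec_injective_iff, linearIndependent_iff_card_eq_finrank_span,
        Set.finrank, ← Matrix.rank_eq_finrank_span_cols, H.rank_P k hk, Fintype.card_fin]
    simpa using ih.conjTranspose_mul_mul_same hinj

/-- `errorIMG` is indeed the error propagation matrix of the multigrid algorithm. -/
theorem cycle_error (γ : ℕ) : ∀ k < L, ∀ u u₀ : Fin (H.n (k + 1)) → ℝ,
    u - H.cycle γ k (H.A (k + 1) *ᵥ u) u₀ = H.errorIMG γ k *ᵥ (u - u₀) := by
  intro k
  induction k with
  | zero =>
    intro _ u u₀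
    exact twoGridStep_error _ _ _ _ _ (fun _ => rfl) u u₀
  | succ k ih =>
    intro hk u u₀
    refine twoGridStep_error _ _ _ _ _ (fun r => ?_) u u₀
    have hA : IsUnit (H.A (k + 1)) := (H.posDef_A (k + 1) (by omega)).isUnit
    have hdet : IsUnit (H.A (k + 1)).det := (Matrix.isUnit_iff_isUnit_det _).1 hA
    obtain ⟨v, rfl⟩ : ∃ v, r = H.A (k + 1) *ᵥ v :=
      ⟨(H.A (k + 1))⁻¹ *ᵥ r, by
        rw [Matrix.mulVec_mulVec, Matrix.mul_nonsing_inv _ hdet, Matrix.one_mulVec]⟩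
    have key : ∀ j : ℕ, v - (H.cycle γ k (H.A (k + 1) *ᵥ v))^[j] 0 =
        (H.errorIMG γ k ^ j) *ᵥ v := by
      intro j
      induction j with
      | zero => simp
      | succ j ihj =>
        rw [Function.iterate_succ_apply', ih (by omega), ihj, Matrix.mulVec_mulVec, pow_succ']
    rw [Matrix.mulVec_mulVec, Matrix.mul_assoc, Matrix.nonsing_inv_mul _ hdet, Matrix.mul_one,
      Matrix.sub_mulVec, Matrix.one_mulVec, ← key γ]
    abel

end MultigridHierarchy

end

/-!
Everything is read off quadratic forms in the energy inner product `⟨u, v⟩_A = uᵀ A v`. On one level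
write `S = I - M⁻¹ A`, let `C` be the coarse solver and `C⁻¹ = Pᵀ A P + D` with `D ≥ 0`. The
two-grid error `E` is self-adjoint for `⟨·, ·⟩_A` with `0 ≤ E < I`, so its energy norm is at most `x`
as soon as its form is at most `x ‖·‖_A²` (`EnergyBounded`).

The key is the variational identity `SmoothingLevel.functional_eq`: for `v = (I - E) y`, the
minimum over `b` of `bᵀ D b + ‖S v - P b‖²_M̃` is `⟨v, E y⟩_A`. For the exact two-grid method
(`D = 0`), a bound `σ < 1` on the error makes this minimum at most `σ / (1 - σ) ‖v‖_A²`; also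
`‖S v‖²_M̃ ≤ (1 - ε) / ε ‖v‖_A²`. If `D ≤ δ Pᵀ M̃ P`, inserting the exact minimizer damped by
`1 / (1 + δ)` bounds the inexact minimum, and evaluating it at an eigenvector of `E` gives
`E ≤ (σ ε + δ (1 - ε) (1 - σ)) / (ε + δ (1 - σ))` (`SmoothingLevel.twoGridError_le`).

In the multigrid recursion the coarse solver is `(I - R) A_c⁻¹`, where `A_c` is the coarse matrix
and `R` is the `γ`-th power of the coarser error. If that error is at most `x`, then
`D = A_c ((I - R)⁻¹ - I) ≤ x ^ γ / (1 - x ^ γ) A_c ≤ τ x ^ γ / (1 - x ^ γ) Pᵀ M̃ P`, so the next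
level is bounded by `mgBound x`. The coarse condition ensures that level `1` is bounded by
`x`; a fixed point `x` of `mgBound` therefore bounds all levels.

For `γ = 1` the fixed points are the roots of a quadratic that is positive at `σ` and negative at
`1 - ε`, which identifies `x₁`. For `γ = 2`, a root `x₂` satisfies `x₂ ≤ x₁` because `mgBound`
is increasing in `x ^ γ`, and applying `mgBound` to this inequality gives `x₂ ≤ x̂₂`; when
`τ (1 - σ) = ε` the equation for `x₂` is itself quadratic.
-/

/-! ### Generalized eigenvalues and quadratic forms -/

theorem Matrix.IsHermitian.transpose_eq {m : ℕ} {S : Matrix (Fin m) (Fin m) ℝ}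
    (hS : S.IsHermitian) : Sᵀ = S := by
  simpa [Matrix.IsHermitian] using hS

/-- A real symmetric matrix moves freely across the dot product. -/
theorem dotProduct_mulVec_symm {m : ℕ} {S : Matrix (Fin m) (Fin m) ℝ} (hS : Sᵀ = S)
    (u v : Fin m → ℝ) : u ⬝ᵥ S *ᵥ v = v ⬝ᵥ S *ᵥ u := by
  rw [Matrix.dotProduct_mulVec, ← Matrix.mulVec_transpose, hS, dotProduct_comm]

theorem dotProduct_mulVec_transpose {m c : ℕ} (P : Matrix (Fin m) (Fin c) ℝ)
    (u : Fin c → ℝ) (v : Fin m → ℝ) : u ⬝ᵥ Pᵀ *ᵥ v = (P *ᵥ u) ⬝ᵥ v := by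
  rw [Matrix.dotProduct_mulVec, Matrix.vecMul_transpose]

theorem mem_spectrum_inv_mul {m : ℕ} {B S : Matrix (Fin m) (Fin m) ℝ} (hB : IsUnit B.det)
    {l : ℝ} {v : Fin m → ℝ} (hv : v ≠ 0) (h : S *ᵥ v = l • B *ᵥ v) :
    l ∈ spectrum ℝ (B⁻¹ * S) := by
  rw [← AlgEquiv.spectrum_eq Matrix.toLinAlgEquiv', ← Module.End.hasEigenvalue_iff_mem_spectrum]
  refine Module.End.hasEigenvalue_of_hasEigenvector (x := v) ⟨?_, hv⟩
  rw [Module.End.mem_eigenspace_iff, Matrix.toLinAlgEquiv'_apply, ← Matrix.mulVec_mulVec, h,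
    Matrix.mulVec_smul, Matrix.mulVec_mulVec, Matrix.nonsing_inv_mul _ hB, Matrix.one_mulVec]

theorem exists_of_mem_spectrum_inv_mul {m : ℕ} {B S : Matrix (Fin m) (Fin m) ℝ}
    (hB : IsUnit B.det) {l : ℝ} (h : l ∈ spectrum ℝ (B⁻¹ * S)) :
    ∃ v, v ≠ 0 ∧ S *ᵥ v = l • B *ᵥ v := by
  rw [← AlgEquiv.spectrum_eq Matrix.toLinAlgEquiv',
    ← Module.End.hasEigenvalue_iff_mem_spectrum] at h
  obtain ⟨v, hv, hv0⟩ := h.exists_hasEigenvector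
  refine ⟨v, hv0, ?_⟩
  rw [Module.End.mem_eigenspace_iff, Matrix.toLinAlgEquiv'_apply] at hv
  rw [← Matrix.mulVec_smul, ← hv, Matrix.mulVec_mulVec, ← Matrix.mul_assoc,
    Matrix.mul_nonsing_inv _ hB, Matrix.one_mul]

theorem Matrix.PosDef.isUnit_det' {m : ℕ} {B : Matrix (Fin m) (Fin m) ℝ} (hB : B.PosDef) :
    IsUnit B.det := (Matrix.isUnit_iff_isUnit_det _).1 hB.isUnit

open scoped MatrixOrder Matrix.Norms.L2Operator in
/-- An upper bound for the generalized eigenvalues of the pencil `(S, B)` bounds the quadratic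
form of `S` by that of `B`: with `B = Rᵀ R` this is the spectral theorem for `R⁻ᵀ S R⁻¹`. -/
theorem form_le_of_eigenvalues_le {m : ℕ} {B S : Matrix (Fin m) (Fin m) ℝ} (hB : B.PosDef)
    (hS : Sᵀ = S) {c : ℝ}
    (h : ∀ (l : ℝ) (v : Fin m → ℝ), v ≠ 0 → S *ᵥ v = l • B *ᵥ v → l ≤ c) (v : Fin m → ℝ) :
    v ⬝ᵥ S *ᵥ v ≤ c * (v ⬝ᵥ B *ᵥ v) := by
  obtain ⟨R, hR⟩ : ∃ R : Matrix (Fin m) (Fin m) ℝ, B = Rᵀ * R := by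
    obtain ⟨R, hR⟩ := CStarAlgebra.nonneg_iff_eq_star_mul_self.1 hB.posSemidef.nonneg
    exact ⟨R, by simpa [Matrix.star_eq_conjTranspose] using hR⟩
  have hRu : IsUnit R.det := by
    have := hB.isUnit_det'
    rw [hR, Matrix.det_mul] at this
    exact isUnit_of_mul_isUnit_right this
  have hRtu : IsUnit Rᵀ.det := by rwa [Matrix.det_transpose]
  set K : Matrix (Fin m) (Fin m) ℝ := c • 1 - Rᵀ⁻¹ * S * R⁻¹ with hK
  have hKh : K.IsHermitian := by
    have : Kᵀ = K := by
      simp [hK, Matrix.transpose_mul, Matrix.transpose_nonsing_inv, hS, Matrix.mul_assoc]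
    simpa [Matrix.IsHermitian] using this
  have hKs : K.PosSemidef := by
    rw [hKh.posSemidef_iff_eigenvalues_nonneg]
    intro i
    set e : Fin m → ℝ := (hKh.eigenvectorBasis i).ofLp with he
    have hev : K *ᵥ e = hKh.eigenvalues i • e := hKh.mulVec_eigenvectorBasis i
    have he0 : e ≠ 0 := by
      intro h0
      apply hKh.eigenvectorBasis.orthonormal.ne_zero i
      ext j
      simpa using congrFun h0 j
    have hw : Rᵀ⁻¹ *ᵥ S *ᵥ R⁻¹ *ᵥ e = (c - hKh.eigenvalues i) • e := by
      have h0 : K *ᵥ e = c • e - Rᵀ⁻¹ *ᵥ S *ᵥ R⁻¹ *ᵥ e := by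
        simp [hK, Matrix.sub_mulVec, Matrix.smul_mulVec, Matrix.mulVec_mulVec, Matrix.mul_assoc]
      rw [sub_smul, ← hev, h0, sub_sub_cancel]
    have := h (c - hKh.eigenvalues i) (R⁻¹ *ᵥ e) (by
      intro h0
      apply he0
      rw [← Matrix.one_mulVec e, ← Matrix.mul_nonsing_inv _ hRu, ← Matrix.mulVec_mulVec, h0,
        Matrix.mulVec_zero]) (by
      have h2 := congrArg (fun w => Rᵀ *ᵥ w) hw
      simp only [Matrix.mulVec_mulVec, Matrix.mulVec_smul] at h2
      rw [← Matrix.mul_assoc, Matrix.mul_nonsing_inv _ hRtu, Matrix.one_mul] at h2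
      rw [hR]
      simp only [Matrix.mulVec_mulVec]
      rw [h2, Matrix.mul_assoc, Matrix.mul_nonsing_inv _ hRu, Matrix.mul_one])
    simp only [Pi.zero_apply]
    linarith
  have h1 := hKs.dotProduct_mulVec_nonneg (R *ᵥ v)
  have h2 : c • B - S = Rᵀ * K * R := by
    rw [hK, Matrix.mul_sub, Matrix.sub_mul]
    congr 1
    · simp [hR]
    · rw [show Rᵀ * (Rᵀ⁻¹ * S * R⁻¹) * R = (Rᵀ * Rᵀ⁻¹) * S * (R⁻¹ * R) by
        simp only [Matrix.mul_assoc], Matrix.mul_nonsing_inv _ hRtu, Matrix.nonsing_inv_mul _ hRu,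
        Matrix.one_mul, Matrix.mul_one]
  have h3 : v ⬝ᵥ (c • B - S) *ᵥ v = star (R *ᵥ v) ⬝ᵥ K *ᵥ R *ᵥ v := by
    rw [h2, star_trivial, ← dotProduct_mulVec_transpose, Matrix.mulVec_mulVec,
      Matrix.mulVec_mulVec, Matrix.mul_assoc]
  rw [← h3, Matrix.sub_mulVec, Matrix.smul_mulVec, dotProduct_sub, dotProduct_smul,
    smul_eq_mul] at h1
  linarith

theorem le_form_of_le_eigenvalues {m : ℕ} {B S : Matrix (Fin m) (Fin m) ℝ} (hB : B.PosDef)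
    (hS : Sᵀ = S) {c : ℝ}
    (h : ∀ (l : ℝ) (v : Fin m → ℝ), v ≠ 0 → S *ᵥ v = l • B *ᵥ v → c ≤ l) (v : Fin m → ℝ) :
    c * (v ⬝ᵥ B *ᵥ v) ≤ v ⬝ᵥ S *ᵥ v := by
  have := form_le_of_eigenvalues_le (S := -S) (c := -c) hB (by simp [hS]) (fun l v hv hl => by
    have := h (-l) v hv (by rw [neg_smul, ← hl]; simp [Matrix.neg_mulVec])
    linarith) v
  rw [Matrix.neg_mulVec, dotProduct_neg] at this
  linarith

theorem spectrum_inv_mul_nonempty {m : ℕ} (hm : 0 < m) {B S : Matrix (Fin m) (Fin m) ℝ}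
    (hB : B.PosDef) (hS : Sᵀ = S) : (spectrum ℝ (B⁻¹ * S)).Nonempty := by
  by_contra hne
  -- Without eigenvalues, every constant would be a bound for the form of `S`.
  have key : ∀ c : ℝ, ∀ v : Fin m → ℝ, v ⬝ᵥ S *ᵥ v ≤ c * (v ⬝ᵥ B *ᵥ v) := fun c =>
    form_le_of_eigenvalues_le hB hS fun l v hv hl =>
      absurd ⟨l, mem_spectrum_inv_mul hB.isUnit_det' hv hl⟩ hne
  have hv : (Pi.single ⟨0, hm⟩ 1 : Fin m → ℝ) ≠ 0 := by simp
  have hp := hB.dotProduct_mulVec_pos hv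
  rw [star_trivial] at hp
  have := key (((Pi.single ⟨0, hm⟩ 1 : Fin m → ℝ) ⬝ᵥ S *ᵥ Pi.single ⟨0, hm⟩ 1 - 1) /
    ((Pi.single ⟨0, hm⟩ 1 : Fin m → ℝ) ⬝ᵥ B *ᵥ Pi.single ⟨0, hm⟩ 1)) (Pi.single ⟨0, hm⟩ 1)
  rw [div_mul_cancel₀ _ hp.ne'] at this
  linarith

theorem pos_of_mem_spectrum_inv_mul {m : ℕ} {B S : Matrix (Fin m) (Fin m) ℝ}
    (hB : B.PosDef) (hS : S.PosDef) {l : ℝ} (hl : l ∈ spectrum ℝ (B⁻¹ * S)) : 0 < l := by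
  obtain ⟨v, hv, h⟩ := exists_of_mem_spectrum_inv_mul hB.isUnit_det' hl
  have h1 := hB.dotProduct_mulVec_pos hv
  have h2 := hS.dotProduct_mulVec_pos hv
  rw [star_trivial] at h1 h2
  rw [h, dotProduct_smul, smul_eq_mul] at h2
  exact pos_of_mul_pos_left h2 h1.le

/-! ### Matrices that are self-adjoint and nonnegative for the energy inner product -/

/-- The matrix `E` is self-adjoint for the inner product `⟨u, v⟩_A = uᵀ A v`, and its spectrum
there lies in `[0, x]`, in the sense of quadratic forms: `0 ≤ ⟨v, E v⟩_A ≤ x ⟨v, v⟩_A`. -/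
structure EnergyBounded {m : ℕ} (A E : Matrix (Fin m) (Fin m) ℝ) (x : ℝ) : Prop where
  symm : (A * E)ᵀ = A * E
  nonneg : ∀ v, 0 ≤ v ⬝ᵥ A *ᵥ E *ᵥ v
  le : ∀ v, v ⬝ᵥ A *ᵥ E *ᵥ v ≤ x * (v ⬝ᵥ A *ᵥ v)

namespace EnergyBounded

variable {m : ℕ} {A E : Matrix (Fin m) (Fin m) ℝ} {x : ℝ}

theorem comm (h : (A * E)ᵀ = A * E) (u v : Fin m → ℝ) :
    u ⬝ᵥ A *ᵥ E *ᵥ v = v ⬝ᵥ A *ᵥ E *ᵥ u := by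
  rw [Matrix.mulVec_mulVec, Matrix.mulVec_mulVec, dotProduct_mulVec_symm h]

/-- `⟨E v, (x - E) v⟩_A ≥ 0`, because
`x E (x - E) = E (x - E) E + (x - E) E (x - E)`. -/
theorem form_sq_le (h : EnergyBounded A E x) (hx : 0 < x) (v : Fin m → ℝ) :
    (E *ᵥ v) ⬝ᵥ A *ᵥ E *ᵥ v ≤ x * (v ⬝ᵥ A *ᵥ E *ᵥ v) := by
  have h1 := h.le (E *ᵥ v)
  have h2 := h.nonneg (x • v - E *ᵥ v)
  have c1 := comm h.symm v (E *ᵥ v)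
  simp only [Matrix.mulVec_sub, Matrix.mulVec_smul, dotProduct_sub, sub_dotProduct,
    dotProduct_smul, smul_dotProduct, smul_eq_mul] at h2
  rw [c1] at h2
  nlinarith

theorem form_sq_le_sq (h : EnergyBounded A E x) (hx : 0 < x) (v : Fin m → ℝ) :
    (E *ᵥ v) ⬝ᵥ A *ᵥ E *ᵥ v ≤ x ^ 2 * (v ⬝ᵥ A *ᵥ v) := by
  have h1 := h.form_sq_le hx v
  have h2 := h.le v
  nlinarith

/-- `⟨(1 - E) v, (x - E) v⟩_A ≥ 0` for `x ≤ 1`. -/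
theorem form_one_sub_le (h : EnergyBounded A E x) (hA : A.PosDef) (hx : x ≤ 1)
    (v : Fin m → ℝ) :
    (1 - x) * ((v - E *ᵥ v) ⬝ᵥ A *ᵥ E *ᵥ v) ≤
      x * ((v - E *ᵥ v) ⬝ᵥ A *ᵥ (v - E *ᵥ v)) := by
  have h1 := hA.posSemidef.dotProduct_mulVec_nonneg (x • v - E *ᵥ v)
  have h2 := mul_nonneg (sub_nonneg.2 hx) (sub_nonneg.2 (h.le v))
  have c1 := dotProduct_mulVec_symm hA.isHermitian.transpose_eq v (E *ᵥ v)
  simp only [star_trivial, Matrix.mulVec_sub, Matrix.mulVec_smul, dotProduct_sub, sub_dotProduct,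
    dotProduct_smul, smul_dotProduct, smul_eq_mul] at h1 ⊢
  rw [← c1] at h1 ⊢
  linarith

theorem isUnit_one_sub (h : EnergyBounded A E x) (hA : A.PosDef) (hx : x < 1) :
    IsUnit (1 - E).det := by
  rw [← Matrix.isUnit_iff_isUnit_det, ← Matrix.mulVec_injective_iff_isUnit]
  refine (injective_iff_map_eq_zero (Matrix.mulVecLin (1 - E))).2 fun v h0 => ?_
  by_contra hv
  have h0' : E *ᵥ v = v := by
    have : (1 - E) *ᵥ v = 0 := h0
    rw [Matrix.sub_mulVec, Matrix.one_mulVec, sub_eq_zero] at this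
    exact this.symm
  have h1 := h.le v
  have h2 := hA.dotProduct_mulVec_pos hv
  rw [star_trivial] at h2
  rw [h0'] at h1
  nlinarith

theorem exists_eq_sub (h : EnergyBounded A E x) (hA : A.PosDef) (hx : x < 1) (v : Fin m → ℝ) :
    ∃ y, v = y - E *ᵥ y := by
  refine ⟨(1 - E)⁻¹ *ᵥ v, ?_⟩
  have : (1 - E) *ᵥ (1 - E)⁻¹ *ᵥ v = v := by
    rw [Matrix.mulVec_mulVec, Matrix.mul_nonsing_inv _ (h.isUnit_one_sub hA hx),
      Matrix.one_mulVec]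
  rw [Matrix.sub_mulVec, Matrix.one_mulVec] at this
  exact this.symm

theorem pow (h : EnergyBounded A E x) (hA : A.PosDef) (hx : 0 < x) {g : ℕ} (hg : g = 1 ∨ g = 2) :
    EnergyBounded A (E ^ g) (x ^ g) := by
  rcases hg with rfl | rfl
  · simpa using h
  have hc : ∀ v, v ⬝ᵥ A *ᵥ (E ^ 2) *ᵥ v = (E *ᵥ v) ⬝ᵥ A *ᵥ E *ᵥ v := fun v => by
    rw [pow_two, ← Matrix.mulVec_mulVec, comm h.symm]
  refine ⟨?_, fun v => ?_, fun v => ?_⟩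
  · have h1 : Eᵀ * A = A * E := by simpa [Matrix.transpose_mul, hA.isHermitian.transpose_eq]
      using h.symm
    rw [pow_two, Matrix.transpose_mul, Matrix.transpose_mul, hA.isHermitian.transpose_eq,
      Matrix.mul_assoc, h1, ← Matrix.mul_assoc, h1, Matrix.mul_assoc]
  · rw [hc]
    simpa using hA.posSemidef.dotProduct_mulVec_nonneg (E *ᵥ v)
  · rw [hc]
    exact h.form_sq_le_sq hx v

theorem energyNorm_ratio_le (h : EnergyBounded A E x) (hx : 0 < x) (v : Fin m → ℝ) :
    energyNorm A (E *ᵥ v) / energyNorm A v ≤ x := by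
  refine div_le_of_le_mul₀ (Real.sqrt_nonneg _) hx.le ?_
  rw [energyNorm, energyNorm, ← Real.sqrt_sq hx.le, ← Real.sqrt_mul (sq_nonneg x),
    dotProduct_comm, dotProduct_comm (A *ᵥ v)]
  exact Real.sqrt_le_sqrt (h.form_sq_le_sq hx v)

theorem energyOpNorm_le (h : EnergyBounded A E x) (hx : 0 < x) : energyOpNorm A E ≤ x :=
  Real.iSup_le (fun v => h.energyNorm_ratio_le hx v.1) hx.le

/-- A bound for the energy norm of `E` bounds its quadratic form, by the Cauchy–Schwarz
inequality. The a priori bound `x` ensures that the supremum defining the norm is not junk. -/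
theorem of_energyOpNorm_le (h : EnergyBounded A E x) (hA : A.PosDef) (hx : 0 < x) {s : ℝ}
    (hs : 0 < s) (hE : energyOpNorm A E ≤ s) : EnergyBounded A E s := by
  refine ⟨h.symm, h.nonneg, fun v => ?_⟩
  rcases eq_or_ne v 0 with rfl | hv
  · simp
  have hb : BddAbove (Set.range fun v : {v : Fin m → ℝ // v ≠ 0} =>
      energyNorm A (E *ᵥ v.1) / energyNorm A v.1) :=
    ⟨x, by rintro _ ⟨w, rfl⟩; exact h.energyNorm_ratio_le hx w.1⟩
  have h1 : energyNorm A (E *ᵥ v) / energyNorm A v ≤ s :=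
    (le_ciSup hb ⟨v, hv⟩).trans hE
  have hp := hA.dotProduct_mulVec_pos hv
  rw [star_trivial] at hp
  have hn := hA.posSemidef.dotProduct_mulVec_nonneg (E *ᵥ v)
  rw [star_trivial] at hn
  rw [energyNorm, energyNorm, dotProduct_comm, dotProduct_comm (A *ᵥ v),
    div_le_iff₀ (Real.sqrt_pos.2 hp)] at h1
  have h2 : (E *ᵥ v) ⬝ᵥ A *ᵥ E *ᵥ v ≤ s ^ 2 * (v ⬝ᵥ A *ᵥ v) := by
    rw [← Real.sq_sqrt hn, ← Real.sq_sqrt hp.le, ← mul_pow]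
    exact pow_le_pow_left₀ (Real.sqrt_nonneg _) h1 2
  have h3 := hA.posSemidef.dotProduct_mulVec_nonneg (s • v - E *ᵥ v)
  have c1 := dotProduct_mulVec_symm hA.isHermitian.transpose_eq v (E *ᵥ v)
  simp only [star_trivial, Matrix.mulVec_sub, Matrix.mulVec_smul, dotProduct_sub, sub_dotProduct,
    dotProduct_smul, smul_dotProduct, smul_eq_mul] at h3
  rw [← c1] at h3
  nlinarith

end EnergyBounded

/-! ### The symmetric two-grid scheme with an inexact coarse solver -/

/-- The assumptions on one level: an SPD system matrix `A`, a convergent smoother `M`, and a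
prolongation `P` of full column rank. -/
structure SmoothingLevel {m c : ℕ} (A M : Matrix (Fin m) (Fin m) ℝ)
    (P : Matrix (Fin m) (Fin c) ℝ) : Prop where
  posDef : A.PosDef
  isUnit_M : IsUnit M.det
  posDef_M : (M + Mᵀ - A).PosDef
  injective : Function.Injective P.mulVec

/-- The coarse solver `C` is the inverse of `Pᵀ A P + D`, where the defect `D` from the Galerkin
matrix is positive semidefinite. -/
structure CoarseSolver {m c : ℕ} (A : Matrix (Fin m) (Fin m) ℝ) (P : Matrix (Fin m) (Fin c) ℝ)
    (C D : Matrix (Fin c) (Fin c) ℝ) : Prop where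
  posSemidef : D.PosSemidef
  inv_eq : C = (Pᵀ * A * P + D)⁻¹

namespace SmoothingLevel

variable {m c : ℕ} {A M : Matrix (Fin m) (Fin m) ℝ} {P : Matrix (Fin m) (Fin c) ℝ}

theorem symm (h : SmoothingLevel A M P) : Aᵀ = A := h.posDef.isHermitian.transpose_eq

theorem posDef_symmSmoother (h : SmoothingLevel A M P) : (symmSmoother A M).PosDef := by
  have := h.posDef_M.inv.conjTranspose_mul_mul_same (B := M)
    (Matrix.mulVec_injective_iff_isUnit.2 ((Matrix.isUnit_iff_isUnit_det _).2 h.isUnit_M))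
  simpa [symmSmoother] using this

theorem posDef_galerkin (h : SmoothingLevel A M P) : (Pᵀ * A * P).PosDef := by
  simpa using h.posDef.conjTranspose_mul_mul_same h.injective

theorem posDef_galerkin_symmSmoother (h : SmoothingLevel A M P) :
    (Pᵀ * symmSmoother A M * P).PosDef := by
  simpa using h.posDef_symmSmoother.conjTranspose_mul_mul_same h.injective

theorem isUnit_Mt (h : SmoothingLevel A M P) : IsUnit Mᵀ.det := by
  rw [Matrix.det_transpose]; exact h.isUnit_M

/-- The postsmoother is the adjoint of the presmoother for the energy inner product. -/
theorem mul_postsmoother (h : SmoothingLevel A M P) :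
    A * (1 - Mᵀ⁻¹ * A) = (1 - M⁻¹ * A)ᵀ * A := by
  simp [Matrix.transpose_mul, Matrix.transpose_nonsing_inv, h.symm, Matrix.mul_sub,
    Matrix.sub_mul, Matrix.mul_assoc]

/-- `M̃ (I - (I - M⁻¹ A) (I - M⁻ᵀ A)) = A`. -/
theorem symmSmoother_mul (h : SmoothingLevel A M P) :
    symmSmoother A M * (1 - (1 - M⁻¹ * A) * (1 - Mᵀ⁻¹ * A)) = A := by
  have h1 : 1 - (1 - M⁻¹ * A) * (1 - Mᵀ⁻¹ * A) = M⁻¹ * ((M + Mᵀ - A) * (Mᵀ⁻¹ * A)) := by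
    have e1 : M⁻¹ * (M * (Mᵀ⁻¹ * A)) = Mᵀ⁻¹ * A := by
      rw [← Matrix.mul_assoc, Matrix.nonsing_inv_mul _ h.isUnit_M, Matrix.one_mul]
    have e2 : Mᵀ * (Mᵀ⁻¹ * A) = A := by
      rw [← Matrix.mul_assoc, Matrix.mul_nonsing_inv _ h.isUnit_Mt, Matrix.one_mul]
    rw [Matrix.sub_mul (M + Mᵀ), Matrix.add_mul, e2, Matrix.mul_sub M⁻¹ _ (A * _),
      Matrix.mul_add, e1]
    simp only [Matrix.mul_sub, Matrix.sub_mul, Matrix.one_mul, Matrix.mul_one, Matrix.mul_assoc]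
    abel
  rw [h1, symmSmoother, Matrix.mul_assoc, ← Matrix.mul_assoc M,
    Matrix.mul_nonsing_inv _ h.isUnit_M, Matrix.one_mul, Matrix.mul_assoc Mᵀ,
    ← Matrix.mul_assoc _⁻¹ (M + Mᵀ - A), Matrix.nonsing_inv_mul _ h.posDef_M.isUnit_det',
    Matrix.one_mul, ← Matrix.mul_assoc, Matrix.mul_nonsing_inv _ h.isUnit_Mt, Matrix.one_mul]

theorem inv_symmSmoother_mul (h : SmoothingLevel A M P) :
    (symmSmoother A M)⁻¹ * A = 1 - (1 - M⁻¹ * A) * (1 - Mᵀ⁻¹ * A) := by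
  have := congrArg (fun X => (symmSmoother A M)⁻¹ * X) h.symmSmoother_mul
  simp only [← Matrix.mul_assoc, Matrix.nonsing_inv_mul _ h.posDef_symmSmoother.isUnit_det',
    Matrix.one_mul] at this
  exact this.symm

/-- `‖v‖_A² - ‖(I - M⁻¹ A) v‖_A²` is the form of `M + Mᵀ - A` at `M⁻¹ A v`. -/
theorem presmoother_lt (h : SmoothingLevel A M P) {v : Fin m → ℝ} (hv : v ≠ 0) :
    ((1 - M⁻¹ * A) *ᵥ v) ⬝ᵥ A *ᵥ (1 - M⁻¹ * A) *ᵥ v < v ⬝ᵥ A *ᵥ v := by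
  set r := M⁻¹ *ᵥ A *ᵥ v with hr
  have hMr : M *ᵥ r = A *ᵥ v := by
    rw [hr, Matrix.mulVec_mulVec, Matrix.mul_nonsing_inv _ h.isUnit_M, Matrix.one_mulVec]
  have hr0 : r ≠ 0 := by
    intro h0
    have h1 := h.posDef.dotProduct_mulVec_pos hv
    rw [← hMr, h0, Matrix.mulVec_zero, dotProduct_zero] at h1
    exact lt_irrefl _ h1
  have h1 := h.posDef_M.dotProduct_mulVec_pos hr0
  rw [star_trivial, Matrix.sub_mulVec, Matrix.add_mulVec, dotProduct_sub, dotProduct_add,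
    dotProduct_mulVec_transpose, dotProduct_comm _ r, hMr,
    dotProduct_mulVec_symm h.symm r v] at h1
  have e : (1 - M⁻¹ * A) *ᵥ v = v - r := by
    rw [Matrix.sub_mulVec, Matrix.one_mulVec, hr, Matrix.mulVec_mulVec]
  rw [e]
  simp only [Matrix.mulVec_sub, dotProduct_sub, sub_dotProduct]
  rw [dotProduct_mulVec_symm h.symm r v]
  linarith

variable {C D : Matrix (Fin c) (Fin c) ℝ}

theorem isUnit_coarse (h : SmoothingLevel A M P) (hC : CoarseSolver A P C D) :
    IsUnit (Pᵀ * A * P + D).det :=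
  (h.posDef_galerkin.add_posSemidef hC.posSemidef).isUnit_det'

theorem coarse_eq (h : SmoothingLevel A M P) (hC : CoarseSolver A P C D) (g : Fin c → ℝ) :
    (Pᵀ * A * P) *ᵥ C *ᵥ g + D *ᵥ C *ᵥ g = g := by
  rw [← Matrix.add_mulVec, hC.inv_eq, Matrix.mulVec_mulVec,
    Matrix.mul_nonsing_inv _ (h.isUnit_coarse hC), Matrix.one_mulVec]

theorem twoGridError_mulVec (y : Fin m → ℝ) :
    twoGridError A M P C *ᵥ y = (1 - Mᵀ⁻¹ * A) *ᵥ ((1 - M⁻¹ * A) *ᵥ y -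
      P *ᵥ C *ᵥ Pᵀ *ᵥ A *ᵥ (1 - M⁻¹ * A) *ᵥ y) := by
  rw [twoGridError, ← Matrix.mulVec_mulVec, ← Matrix.mulVec_mulVec]
  congr 1
  rw [Matrix.sub_mulVec 1 (P * C * Pᵀ * A), Matrix.one_mulVec]
  simp only [Matrix.mulVec_mulVec, Matrix.mul_assoc]

theorem form_postsmoother (h : SmoothingLevel A M P) (u v : Fin m → ℝ) :
    u ⬝ᵥ A *ᵥ (1 - Mᵀ⁻¹ * A) *ᵥ v = ((1 - M⁻¹ * A) *ᵥ u) ⬝ᵥ A *ᵥ v := by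
  rw [Matrix.mulVec_mulVec, h.mul_postsmoother, ← Matrix.mulVec_mulVec,
    dotProduct_mulVec_transpose]

theorem form_twoGridError (h : SmoothingLevel A M P) (u v : Fin m → ℝ) :
    u ⬝ᵥ A *ᵥ twoGridError A M P C *ᵥ v = ((1 - M⁻¹ * A) *ᵥ u) ⬝ᵥ A *ᵥ ((1 - M⁻¹ * A) *ᵥ v -
      P *ᵥ C *ᵥ Pᵀ *ᵥ A *ᵥ (1 - M⁻¹ * A) *ᵥ v) := by
  rw [twoGridError_mulVec, h.form_postsmoother]

theorem coarse_symm (h : SmoothingLevel A M P) (hC : CoarseSolver A P C D) : Cᵀ = C := by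
  rw [hC.inv_eq, Matrix.transpose_nonsing_inv]
  simp [Matrix.transpose_mul, h.symm, hC.posSemidef.isHermitian.transpose_eq, Matrix.mul_assoc]

theorem twoGridError_symm (h : SmoothingLevel A M P) (hC : CoarseSolver A P C D) :
    (A * twoGridError A M P C)ᵀ = A * twoGridError A M P C := by
  have e : A * twoGridError A M P C =
      (1 - M⁻¹ * A)ᵀ * (A - A * P * C * Pᵀ * A) * (1 - M⁻¹ * A) := by
    rw [twoGridError, ← Matrix.mul_assoc, ← Matrix.mul_assoc, h.mul_postsmoother,
      Matrix.mul_assoc _ A, Matrix.mul_sub A, Matrix.mul_one]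
    simp only [Matrix.mul_assoc]
  rw [e, Matrix.transpose_mul, Matrix.transpose_mul, Matrix.transpose_transpose]
  simp only [Matrix.transpose_sub, Matrix.transpose_mul, Matrix.transpose_transpose, h.symm,
    h.coarse_symm hC, Matrix.mul_assoc]

/-- The coarse correction with `C` leaves a nonnegative energy. -/
theorem coarse_le (h : SmoothingLevel A M P) (hC : CoarseSolver A P C D) (w : Fin m → ℝ) :
    0 ≤ w ⬝ᵥ A *ᵥ (w - P *ᵥ C *ᵥ Pᵀ *ᵥ A *ᵥ w) ∧
      w ⬝ᵥ A *ᵥ (w - P *ᵥ C *ᵥ Pᵀ *ᵥ A *ᵥ w) ≤ w ⬝ᵥ A *ᵥ w := by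
  set z := C *ᵥ Pᵀ *ᵥ A *ᵥ w with hz
  have h1 : Pᵀ *ᵥ A *ᵥ P *ᵥ z + D *ᵥ z = Pᵀ *ᵥ A *ᵥ w := by
    rw [← h.coarse_eq hC (Pᵀ *ᵥ A *ᵥ w), ← hz, Matrix.mulVec_mulVec, Matrix.mulVec_mulVec]
  have h2 := congrArg (fun g => z ⬝ᵥ g) h1
  simp only [dotProduct_add, dotProduct_mulVec_transpose] at h2
  have h3 := hC.posSemidef.dotProduct_mulVec_nonneg z
  have h4 := h.posDef.posSemidef.dotProduct_mulVec_nonneg (P *ᵥ z)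
  have h5 := h.posDef.posSemidef.dotProduct_mulVec_nonneg (w - P *ᵥ z)
  rw [star_trivial] at h3 h4 h5
  simp only [Matrix.mulVec_sub, dotProduct_sub, sub_dotProduct] at h5 ⊢
  rw [dotProduct_mulVec_symm h.symm w (P *ᵥ z)] at h5 ⊢
  constructor <;> linarith

theorem twoGridError_bounded (h : SmoothingLevel A M P) (hC : CoarseSolver A P C D) :
    EnergyBounded A (twoGridError A M P C) 1 := by
  refine ⟨h.twoGridError_symm hC, fun v => ?_, fun v => ?_⟩
  · rw [h.form_twoGridError]
    exact (h.coarse_le hC _).1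
  · rw [h.form_twoGridError, one_mul]
    refine (h.coarse_le hC _).2.trans ?_
    rcases eq_or_ne v 0 with rfl | hv
    · simp
    · exact (h.presmoother_lt hv).le

theorem twoGridError_lt_one (h : SmoothingLevel A M P) (hC : CoarseSolver A P C D) {l : ℝ}
    {v : Fin m → ℝ} (hv : v ≠ 0) (hl : twoGridError A M P C *ᵥ v = l • v) : l < 1 := by
  have h1 : v ⬝ᵥ A *ᵥ twoGridError A M P C *ᵥ v < v ⬝ᵥ A *ᵥ v := by
    rw [h.form_twoGridError]
    exact (h.coarse_le hC _).2.trans_lt (h.presmoother_lt hv)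
  have h2 := h.posDef.dotProduct_mulVec_pos hv
  rw [star_trivial] at h2
  rw [hl, Matrix.mulVec_smul, dotProduct_smul, smul_eq_mul] at h1
  nlinarith

/-- With `v = (I - E) y` and `z` the coarse correction computed from `y`, the functional
`c ↦ cᵀ D c + ‖(I - M⁻¹ A) v - P c‖²_M̃` is minimal at `z`, where its value is `⟨v, E y⟩_A`. -/
theorem functional_eq (h : SmoothingLevel A M P) (hC : CoarseSolver A P C D)
    {y v : Fin m → ℝ} (hv : v = y - twoGridError A M P C *ᵥ y) {z : Fin c → ℝ}
    (hz : z = C *ᵥ Pᵀ *ᵥ A *ᵥ (1 - M⁻¹ * A) *ᵥ y) (b : Fin c → ℝ) :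
    b ⬝ᵥ D *ᵥ b + ((1 - M⁻¹ * A) *ᵥ v - P *ᵥ b) ⬝ᵥ
        symmSmoother A M *ᵥ ((1 - M⁻¹ * A) *ᵥ v - P *ᵥ b) =
      v ⬝ᵥ A *ᵥ twoGridError A M P C *ᵥ y + (b - z) ⬝ᵥ D *ᵥ (b - z) +
        (P *ᵥ (b - z)) ⬝ᵥ symmSmoother A M *ᵥ P *ᵥ (b - z) := by
  have hE := h.form_twoGridError (C := C) v y
  have hEy := twoGridError_mulVec (A := A) (M := M) (P := P) (C := C) y
  rw [← hz] at hE hEy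
  set N := symmSmoother A M with hN
  set S := 1 - M⁻¹ * A with hS
  set w := S *ᵥ v with hw
  set e := S *ᵥ y - P *ᵥ z with he
  -- `M̃ (S v - P z) = A (S y - P z)`
  have hNe : N *ᵥ (w - P *ᵥ z) = A *ᵥ e := by
    have h1 : A *ᵥ e = N *ᵥ (e - S *ᵥ twoGridError A M P C *ᵥ y) := by
      have h2 : N *ᵥ (1 - S * (1 - Mᵀ⁻¹ * A)) *ᵥ e = A *ᵥ e := by
        rw [Matrix.mulVec_mulVec, hN, hS, h.symmSmoother_mul]
      rw [← h2, Matrix.sub_mulVec 1 (S * _), Matrix.one_mulVec, hEy,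
        Matrix.mulVec_mulVec _ S]
    rw [h1, hw, hv, Matrix.mulVec_sub S, he]
    congr 1
    abel
  -- the optimality condition `D z = Pᵀ M̃ (S v - P z)`
  have hDz : D *ᵥ z = Pᵀ *ᵥ A *ᵥ e := by
    have h1 : Pᵀ *ᵥ A *ᵥ P *ᵥ z + D *ᵥ z = Pᵀ *ᵥ A *ᵥ S *ᵥ y := by
      rw [← h.coarse_eq hC (Pᵀ *ᵥ A *ᵥ S *ᵥ y), ← hz, Matrix.mulVec_mulVec,
        Matrix.mulVec_mulVec]
    rw [he, Matrix.mulVec_sub, Matrix.mulVec_sub, ← h1]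
    abel
  have hNs : Nᵀ = N := h.posDef_symmSmoother.isHermitian.transpose_eq
  have hDs := hC.posSemidef.isHermitian.transpose_eq
  obtain ⟨d, rfl⟩ : ∃ d, b = z + d := ⟨b - z, by abel⟩
  obtain ⟨f, hf⟩ : ∃ f, w = f + P *ᵥ z := ⟨w - P *ᵥ z, by abel⟩
  rw [hf, add_sub_cancel_right] at hNe
  have q1 : d ⬝ᵥ D *ᵥ z = (P *ᵥ d) ⬝ᵥ N *ᵥ f := by
    rw [hDz, dotProduct_mulVec_transpose, hNe]
  have q2 : z ⬝ᵥ D *ᵥ z = (P *ᵥ z) ⬝ᵥ N *ᵥ f := by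
    rw [hDz, dotProduct_mulVec_transpose, hNe]
  rw [hE, ← hNe, hf]
  have e1 : f + P *ᵥ z - P *ᵥ (z + d) = f - P *ᵥ d := by rw [Matrix.mulVec_add]; abel
  rw [e1, add_sub_cancel_left]
  simp only [Matrix.mulVec_sub, Matrix.mulVec_add, dotProduct_sub, sub_dotProduct,
    dotProduct_add, add_dotProduct]
  rw [dotProduct_mulVec_symm hDs z d, dotProduct_mulVec_symm hNs f (P *ᵥ d), q1, q2]
  ring

/-- If `ε M̃ ≤ A` then `ε ‖(I - M⁻¹ A) v‖²_M̃ ≤ (1 - ε) ‖v‖_A²`. -/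
theorem presmoother_form_le (h : SmoothingLevel A M P) {ε : ℝ} (hε : 0 < ε) (hε1 : ε < 1)
    (hb : ∀ u, ε * (u ⬝ᵥ A *ᵥ u) ≤ u ⬝ᵥ A *ᵥ ((symmSmoother A M)⁻¹ * A) *ᵥ u)
    (v : Fin m → ℝ) :
    ε * (((1 - M⁻¹ * A) *ᵥ v) ⬝ᵥ symmSmoother A M *ᵥ (1 - M⁻¹ * A) *ᵥ v) ≤
      (1 - ε) * (v ⬝ᵥ A *ᵥ v) := by
  set N := symmSmoother A M with hN
  set w := (1 - M⁻¹ * A) *ᵥ v with hw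
  set u := A⁻¹ *ᵥ N *ᵥ w with hu
  have hAu : A *ᵥ u = N *ᵥ w := by
    rw [hu, Matrix.mulVec_mulVec, Matrix.mul_nonsing_inv _ h.posDef.isUnit_det',
      Matrix.one_mulVec]
  have hNu : (N⁻¹ * A) *ᵥ u = w := by
    rw [← Matrix.mulVec_mulVec, hAu, Matrix.mulVec_mulVec,
      Matrix.nonsing_inv_mul _ h.posDef_symmSmoother.isUnit_det', Matrix.one_mulVec]
  have h1 := hb u
  rw [hNu, dotProduct_mulVec_symm h.symm u w, hAu] at h1
  -- The lower bound for `‖v‖_A²` comes from its distance to `t (I - M⁻ᵀ A) u`, where the choice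
  -- `t = ε / (1 - ε)` is optimal.
  have h2 := h.posDef.posSemidef.dotProduct_mulVec_nonneg
    ((1 - ε) • v - ε • (1 - Mᵀ⁻¹ * A) *ᵥ u)
  have h3 : v ⬝ᵥ A *ᵥ (1 - Mᵀ⁻¹ * A) *ᵥ u = w ⬝ᵥ N *ᵥ w := by
    rw [h.form_postsmoother, hAu]
  have h4 : ((1 - Mᵀ⁻¹ * A) *ᵥ u) ⬝ᵥ A *ᵥ (1 - Mᵀ⁻¹ * A) *ᵥ u =
      u ⬝ᵥ N *ᵥ w - w ⬝ᵥ N *ᵥ w := by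
    have h5 : (1 - M⁻¹ * A) *ᵥ (1 - Mᵀ⁻¹ * A) *ᵥ u = u - w := by
      rw [← hNu, h.inv_symmSmoother_mul, Matrix.sub_mulVec 1 ((1 - M⁻¹ * A) * _),
        Matrix.one_mulVec, sub_sub_cancel, Matrix.mulVec_mulVec]
    rw [h.form_postsmoother, h5, hAu, sub_dotProduct]
  rw [star_trivial] at h2
  simp only [Matrix.mulVec_sub, Matrix.mulVec_smul, dotProduct_sub, sub_dotProduct,
    dotProduct_smul, smul_dotProduct, smul_eq_mul] at h2
  rw [dotProduct_mulVec_symm h.symm ((1 - Mᵀ⁻¹ * A) *ᵥ u) v, h3, h4] at h2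
  have h6 := mul_le_mul_of_nonneg_left h1 hε.le
  have h7 : 0 < 1 - ε := sub_pos.2 hε1
  refine le_of_mul_le_mul_left ?_ h7
  nlinarith

end SmoothingLevel

/-! ### Comparison of the inexact with the exact two-grid scheme -/

namespace SmoothingLevel

variable {m c : ℕ} {A M : Matrix (Fin m) (Fin m) ℝ} {P : Matrix (Fin m) (Fin c) ℝ}
  {C D : Matrix (Fin c) (Fin c) ℝ}

theorem coarseSolver_exact (A : Matrix (Fin m) (Fin m) ℝ) (P : Matrix (Fin m) (Fin c) ℝ) :
    CoarseSolver A P (Pᵀ * A * P)⁻¹ 0 :=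
  ⟨Matrix.PosSemidef.zero, by rw [add_zero]⟩

/-- The exact two-grid bound `σ` controls the `M̃`-distance of `(I - M⁻¹ A) v` to the range
of `P`. -/
theorem exact_functional_le (h : SmoothingLevel A M P) {σ : ℝ} (hσ : σ < 1)
    (hTG : EnergyBounded A (twoGridError A M P (Pᵀ * A * P)⁻¹) σ) (v : Fin m → ℝ) :
    ∃ (z : Fin c → ℝ) (J : ℝ), (1 - σ) * J ≤ σ * (v ⬝ᵥ A *ᵥ v) ∧
      ∀ b, ((1 - M⁻¹ * A) *ᵥ v - P *ᵥ b) ⬝ᵥ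
          symmSmoother A M *ᵥ ((1 - M⁻¹ * A) *ᵥ v - P *ᵥ b) =
        J + (P *ᵥ (b - z)) ⬝ᵥ symmSmoother A M *ᵥ P *ᵥ (b - z) := by
  set E := twoGridError A M P (Pᵀ * A * P)⁻¹ with hE
  obtain ⟨y, hy⟩ := hTG.exists_eq_sub h.posDef hσ v
  refine ⟨(Pᵀ * A * P)⁻¹ *ᵥ Pᵀ *ᵥ A *ᵥ (1 - M⁻¹ * A) *ᵥ y, v ⬝ᵥ A *ᵥ E *ᵥ y, ?_, fun b => ?_⟩
  · rw [hy]
    exact hTG.form_one_sub_le h.posDef hσ.le y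
  · simpa using h.functional_eq (coarseSolver_exact A P) hy rfl b

/-- **Inexact two-grid bound.** If the defect of the coarse solver satisfies `D ≤ δ Pᵀ M̃ P`, then
the two-grid error is bounded by `(σ ε + δ (1 - ε) (1 - σ)) / (ε + δ (1 - σ))`, where `σ` bounds
the exact two-grid error and `ε M̃ ≤ A`. Indeed the exact coarse correction damped by
`1 / (1 + δ)` is a competitor for the functional whose minimum characterizes the inexact one. -/
theorem twoGridError_le (h : SmoothingLevel A M P) (hC : CoarseSolver A P C D) {σ ε δ x : ℝ}
    (hε : 0 < ε) (hσ : 0 < σ) (hσε : σ < 1 - ε)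
    (hTG : EnergyBounded A (twoGridError A M P (Pᵀ * A * P)⁻¹) σ)
    (hb : ∀ u, ε * (u ⬝ᵥ A *ᵥ u) ≤ u ⬝ᵥ A *ᵥ ((symmSmoother A M)⁻¹ * A) *ᵥ u)
    (hδ : 0 ≤ δ) (hD : ∀ b, b ⬝ᵥ D *ᵥ b ≤ δ * ((P *ᵥ b) ⬝ᵥ symmSmoother A M *ᵥ P *ᵥ b))
    (hx : (σ * ε + δ * (1 - ε) * (1 - σ)) / (ε + δ * (1 - σ)) ≤ x) :
    EnergyBounded A (twoGridError A M P C) x := by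
  have hB := h.twoGridError_bounded hC
  refine ⟨hB.symm, hB.nonneg, ?_⟩
  have h1σ : 0 < 1 - σ := by linarith
  have hden : 0 < ε + δ * (1 - σ) := by positivity
  rw [div_le_iff₀ hden] at hx
  intro v
  rw [Matrix.mulVec_mulVec]
  refine form_le_of_eigenvalues_le h.posDef hB.symm (fun l y hy hl => ?_) v
  have hl' : twoGridError A M P C *ᵥ y = l • y := by
    have := congrArg (fun w => A⁻¹ *ᵥ w) hl
    simpa [Matrix.mulVec_mulVec, Matrix.mulVec_smul, ← Matrix.mul_assoc,
      Matrix.nonsing_inv_mul _ h.posDef.isUnit_det'] using this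
  have hl1 := h.twoGridError_lt_one hC hy hl'
  have hpos := h.posDef.dotProduct_mulVec_pos hy
  rw [star_trivial] at hpos
  set a := y ⬝ᵥ A *ᵥ y with ha
  -- The functional is evaluated for `v = (I - E) y`, which is `(1 - l) y`.
  obtain ⟨z, J, hJ, hz⟩ := h.exact_functional_le (by linarith) hTG
    (y - twoGridError A M P C *ᵥ y)
  have hS := h.presmoother_form_le hε (by linarith) hb (y - twoGridError A M P C *ᵥ y)
  set b := (1 + δ)⁻¹ • z with hbz
  have hF := h.functional_eq hC rfl rfl b (y := y)
  have n1 := hC.posSemidef.dotProduct_mulVec_nonneg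
    (b - C *ᵥ Pᵀ *ᵥ A *ᵥ (1 - M⁻¹ * A) *ᵥ y)
  have n2 := h.posDef_symmSmoother.posSemidef.dotProduct_mulVec_nonneg
    (P *ᵥ (b - C *ᵥ Pᵀ *ᵥ A *ᵥ (1 - M⁻¹ * A) *ᵥ y))
  rw [star_trivial] at n1 n2
  have hz0 := hz 0
  rw [Matrix.mulVec_zero, sub_zero, zero_sub, Matrix.mulVec_neg, Matrix.mulVec_neg,
    neg_dotProduct_neg] at hz0
  have h1δ : 0 < 1 + δ := by linarith
  have hbz' : b - z = (-(δ / (1 + δ))) • z := by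
    have : (-(δ / (1 + δ))) = (1 + δ)⁻¹ - 1 := by field_simp; ring
    rw [hbz, this, sub_smul, one_smul]
  rw [hz0] at hS
  rw [hz b, hbz'] at hF
  have hDb := hD b
  set q := (P *ᵥ z) ⬝ᵥ symmSmoother A M *ᵥ P *ᵥ z with hq
  rw [show P *ᵥ b = (1 + δ)⁻¹ • P *ᵥ z by rw [hbz, Matrix.mulVec_smul]] at hDb
  rw [hl'] at hF hJ hS
  rw [show y - l • y = (1 - l) • y by rw [sub_smul, one_smul]] at hF hJ hS
  simp only [Matrix.mulVec_smul, dotProduct_smul, smul_dotProduct, smul_eq_mul, ← hq, ← ha]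
    at hF hJ hS hDb
  have hF' : l * ((1 - l) * a) * (1 + δ) ≤ J + δ * (J + q) := by
    have e1 : δ * ((1 + δ)⁻¹ * ((1 + δ)⁻¹ * q)) + -(δ / (1 + δ)) * (-(δ / (1 + δ)) * q) =
        δ * q / (1 + δ) := by field_simp
    have e2 : l * ((1 - l) * a) ≤ J + δ * q / (1 + δ) := by
      rw [← e1]; linarith
    calc _ ≤ (J + δ * q / (1 + δ)) * (1 + δ) := mul_le_mul_of_nonneg_right e2 h1δ.le
      _ = J + δ * (J + q) := by field_simp; ring
  have p : 0 < (1 - l) * a := mul_pos (by linarith) hpos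
  have hF2 := mul_le_mul_of_nonneg_left hF' (mul_pos h1σ hε).le
  have hJ2 := mul_le_mul_of_nonneg_left hJ hε.le
  have hS2 := mul_le_mul_of_nonneg_left hS (mul_nonneg hδ h1σ.le)
  have key : l * (ε + δ * (1 - σ)) * ((1 - l) * a) ≤
      (σ * ε + δ * (1 - ε) * (1 - σ)) * ((1 - l) * a) := by linarith
  have := le_of_mul_le_mul_right key p
  exact le_of_mul_le_mul_right (this.trans hx) hden

end SmoothingLevel

/-! ### The scalar fixed-point equation -/

/-- If the quadratic `κ X² - μ X + σ` is negative at `p > 0`, then the closed form is its first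
root to the right of `0`: points of `(0, p)` where the quadratic is nonnegative lie to the left
of it, and positive points where it is nonpositive lie to the right. Writing `y = 1 / X` turns it into the larger root of `σ y² - μ y + κ`, whose leading
coefficient is positive whatever the sign of `κ`. -/
theorem quadratic_first_root {σ μ κ p : ℝ} (hσ : 0 < σ) (hp : 0 < p)
    (hneg : κ * p ^ 2 - μ * p + σ < 0) :
    0 ≤ μ ^ 2 - 4 * σ * κ ∧ 0 < μ + √(μ ^ 2 - 4 * σ * κ) ∧
      2 * σ / (μ + √(μ ^ 2 - 4 * σ * κ)) < p ∧
      (∀ x, 0 < x → x < p → 0 ≤ κ * x ^ 2 - μ * x + σ →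
        x ≤ 2 * σ / (μ + √(μ ^ 2 - 4 * σ * κ))) ∧
      ∀ x, 0 < x → κ * x ^ 2 - μ * x + σ ≤ 0 → 2 * σ / (μ + √(μ ^ 2 - 4 * σ * κ)) ≤ x := by
  have h1 : (2 * σ - μ * p) ^ 2 < (μ ^ 2 - 4 * σ * κ) * p ^ 2 := by nlinarith
  have hd : 0 ≤ μ ^ 2 - 4 * σ * κ := by
    by_contra h
    push Not at h
    nlinarith [sq_nonneg (2 * σ - μ * p), sq_nonneg p]
  set s := √(μ ^ 2 - 4 * σ * κ) with hs
  have hs0 : 0 ≤ s := Real.sqrt_nonneg _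
  have hs2 : s ^ 2 = μ ^ 2 - 4 * σ * κ := Real.sq_sqrt hd
  rw [← hs2, ← mul_pow] at h1
  have h2 := abs_lt.1 (abs_lt_of_sq_lt_sq h1 (by positivity))
  have h3 : 0 < μ + s := by
    by_contra h
    push Not at h
    nlinarith [h2.2]
  refine ⟨hd, h3, ?_, fun x hx hxp hq => ?_, fun x hx hq => ?_⟩
  · rw [div_lt_iff₀ h3]; nlinarith [h2.2]
  · rw [le_div_iff₀ h3]
    have h4 : (s * x) ^ 2 ≤ (2 * σ - μ * x) ^ 2 := by
      rw [mul_pow, hs2]; nlinarith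
    have h5 : -(s * x) < 2 * σ - μ * x := by
      -- `2 σ / x > 2 σ / p > μ - s`
      have : (μ - s) * p < 2 * σ := by linarith [h2.1]
      rcases le_or_gt (μ - s) 0 with h | h
      · nlinarith
      · nlinarith
    have h6 : s * x ≤ 2 * σ - μ * x := by
      by_contra h
      push Not at h
      nlinarith
    linarith
  · rw [div_le_iff₀ h3]
    have h4 : (2 * σ - μ * x) ^ 2 ≤ (s * x) ^ 2 := by
      rw [mul_pow, hs2]; nlinarith
    have h5 := (abs_le.1 (abs_le_of_sq_le_sq h4 (by positivity))).2
    linarith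

theorem quadratic_first_root_eq {σ μ κ : ℝ} (hd : 0 ≤ μ ^ 2 - 4 * σ * κ)
    (hpos : 0 < μ + √(μ ^ 2 - 4 * σ * κ)) {x : ℝ}
    (hx : x = 2 * σ / (μ + √(μ ^ 2 - 4 * σ * κ))) : κ * x ^ 2 - μ * x + σ = 0 := by
  have hs2 := Real.sq_sqrt hd
  set s := √(μ ^ 2 - 4 * σ * κ) with hs
  rw [hx]
  field_simp
  linear_combination σ * hs2

section Scalar

variable {σ τ ε : ℝ}

theorem mgBound_den_pos (hε : 0 < ε) (hσε : σ < 1 - ε) (hτ : 0 < τ) (γ : ℕ)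
    {x : ℝ} (hx0 : 0 < x) (hx1 : x < 1) :
    0 < ε * (1 - x ^ γ) + τ * (1 - σ) * x ^ γ := by
  have h1 : x ^ γ ≤ 1 := pow_le_one₀ hx0.le hx1.le
  have h2 : 0 < x ^ γ := pow_pos hx0 γ
  have h3 : 0 < 1 - σ := by linarith
  have h4 : 0 ≤ 1 - x ^ γ := by linarith
  positivity

/-- The recursive bound is increasing in `x ^ γ`, because `σ < 1 - ε`. -/
theorem mgBound_mono (hε : 0 < ε) (hσε : σ < 1 - ε) (hτ : 0 < τ) {γ γ' : ℕ}
    {x y : ℝ} (hx0 : 0 < x) (hx1 : x < 1) (hy0 : 0 < y) (hy1 : y < 1) (h : x ^ γ ≤ y ^ γ') :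
    mgBound σ τ ε γ x ≤ mgBound σ τ ε γ' y := by
  rw [mgBound, mgBound, div_le_div_iff₀ (mgBound_den_pos hε hσε hτ γ hx0 hx1)
    (mgBound_den_pos hε hσε hτ γ' hy0 hy1)]
  have h3 : 0 < 1 - σ := by linarith
  have h4 : 0 < 1 - ε - σ := by linarith
  have : 0 ≤ (1 - ε - σ) * ε * (τ * (1 - σ)) * (y ^ γ' - x ^ γ) :=
    mul_nonneg (by positivity) (by linarith)
  linarith

theorem mgBound_one_sub (hε : 0 < ε) (hσε : σ < 1 - ε) (hτ : 0 < τ) {x : ℝ} (hx0 : 0 < x)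
    (hx1 : x < 1) : mgBound σ τ ε 1 x - x =
      ε / (ε * (1 - x) + τ * (1 - σ) * x) *
        ((1 - τ / ε * (1 - σ)) * x ^ 2 - muL σ τ ε * x + σ) := by
  have hden := mgBound_den_pos hε hσε hτ 1 hx0 hx1
  rw [pow_one] at hden
  rw [mgBound, muL, pow_one, div_sub' hden.ne', div_mul_eq_mul_div, div_left_inj' hden.ne']
  field_simp
  ring

theorem quadratic_neg (hε : 0 < ε) (hσε : σ < 1 - ε) :
    (1 - τ / ε * (1 - σ)) * (1 - ε) ^ 2 - muL σ τ ε * (1 - ε) + σ < 0 := by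
  have : (1 - τ / ε * (1 - σ)) * (1 - ε) ^ 2 - muL σ τ ε * (1 - ε) + σ =
      -(ε * (1 - ε - σ)) := by
    rw [muL]; field_simp; ring
  rw [this]
  nlinarith

theorem isMGRoot_one_iff (hε : 0 < ε) (hσ : 0 < σ) (hσε : σ < 1 - ε) (hτ : 0 < τ) (x : ℝ) :
    IsMGRoot σ τ ε 1 x ↔ x = xOne σ τ ε := by
  obtain ⟨hd, hpos, hlt, hle, hge⟩ :=
    quadratic_first_root hσ (hσ.trans hσε) (quadratic_neg (τ := τ) hε hσε)
  have hroot := quadratic_first_root_eq hd hpos (x := xOne σ τ ε) rfl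
  -- The quadratic is positive at `σ`, so its first root lies beyond `σ`.
  have hσx : σ < xOne σ τ ε := by
    have h1 : 0 < (1 - τ / ε * (1 - σ)) * σ ^ 2 - muL σ τ ε * σ + σ := by
      have : (1 - τ / ε * (1 - σ)) * σ ^ 2 - muL σ τ ε * σ + σ =
          τ / ε * (1 - σ) * σ * (1 - ε - σ) := by
        rw [muL]; field_simp; ring
      rw [this]
      have h3 : 0 < 1 - σ := by linarith
      have h4 : 0 < 1 - ε - σ := by linarith
      positivity
    refine lt_of_le_of_ne (hle σ hσ hσε h1.le) fun h => ?_
    rw [← h] at hroot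
    exact h1.ne' hroot
  have key : ∀ x, IsMGRoot σ τ ε 1 x ↔ x ∈ Set.Ioo σ (1 - ε) ∧
      (1 - τ / ε * (1 - σ)) * x ^ 2 - muL σ τ ε * x + σ = 0 := fun x => by
    refine and_congr_right fun hx => ?_
    have hx0 := hσ.trans hx.1
    have hx1 : x < 1 := by linarith [hx.2]
    have hden := mgBound_den_pos hε hσε hτ 1 hx0 hx1
    rw [pow_one] at hden
    rw [mgBound_one_sub hε hσε hτ hx0 hx1, mul_eq_zero, or_iff_right (div_pos hε hden).ne']
  rw [key]
  constructor
  · rintro ⟨hx, hq⟩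
    exact le_antisymm (hle x (hσ.trans hx.1) hx.2 hq.ge) (hge x (hσ.trans hx.1) hq.le)
  · rintro rfl
    exact ⟨⟨hσx, hlt⟩, hroot⟩

theorem le_xOne (hε : 0 < ε) (hσ : 0 < σ) (hσε : σ < 1 - ε) (hτ : 0 < τ) {x : ℝ}
    (hx : x ∈ Set.Ioo σ (1 - ε)) (h : x ≤ mgBound σ τ ε 1 x) : x ≤ xOne σ τ ε := by
  obtain ⟨-, -, -, hle, -⟩ :=
    quadratic_first_root hσ (hσ.trans hσε) (quadratic_neg (τ := τ) hε hσε)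
  have hx0 := hσ.trans hx.1
  have hx1 : x < 1 := by linarith [hx.2]
  have hden := mgBound_den_pos hε hσε hτ 1 hx0 hx1
  rw [pow_one] at hden
  have h1 := mgBound_one_sub hε hσε hτ hx0 hx1
  refine hle x hx0 hx.2 ?_
  by_contra hn
  push Not at hn
  have := mul_neg_of_pos_of_neg (div_pos hε hden) hn
  linarith

theorem le_xHatTwo (hε : 0 < ε) (hσ : 0 < σ) (hσε : σ < 1 - ε) (hτ : 0 < τ) {x : ℝ}
    (hx : IsMGRoot σ τ ε 2 x) : x ≤ xHatTwo σ τ ε := by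
  have hx0 := hσ.trans hx.1.1
  have hx1 : x < 1 := by linarith [hx.1.2]
  have hroot := sub_eq_zero.1 hx.2
  rw [xHatTwo]
  split_ifs with h
  · have hq : (1 - σ - ε) * x ^ 2 - 1 * x + σ = 0 := by
      have hden := mgBound_den_pos hε hσε hτ 2 hx0 hx1
      rw [mgBound, div_eq_iff hden.ne', mul_right_comm τ, h] at hroot
      have : ε * ((1 - σ - ε) * x ^ 2 - 1 * x + σ) = 0 := by linear_combination hroot
      exact (mul_eq_zero.1 this).resolve_left hε.ne'
    have hneg : (1 - σ - ε) * (1 - ε) ^ 2 - 1 * (1 - ε) + σ < 0 := by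
      have h4 : 0 < 1 - ε - σ := by linarith
      have h5 : 0 < ε * (2 - ε) := by nlinarith
      nlinarith [mul_pos h4 h5]
    have := (quadratic_first_root hσ (hσ.trans hσε) hneg).2.2.2.1 x hx0 hx.1.2 hq.ge
    simpa using this
  · obtain ⟨⟨h1, h2⟩, -⟩ := (isMGRoot_one_iff hε hσ hσε hτ _).2 rfl
    have hle : x ≤ xOne σ τ ε := by
      refine le_xOne hε hσ hσε hτ hx.1 ?_
      conv_lhs => rw [← hroot]
      exact mgBound_mono hε hσε hτ hx0 hx1 hx0 hx1 (by nlinarith)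
    conv_lhs => rw [← hroot]
    exact mgBound_mono hε hσε hτ hx0 hx1 (hσ.trans h1) (by linarith)
      (pow_le_pow_left₀ hx0.le hle 2)

end Scalar

/-! ### The multigrid recursion -/

/-- The coarse solver `(I - R) Aᵣ⁻¹` with a contraction `R` and the Galerkin matrix
`Aᵣ = Pᵀ A P` is the inverse of `Aᵣ + D`, where `D = Aᵣ ((I - R)⁻¹ - I)` is at most
`ρ / (1 - ρ)` times `Aᵣ`. -/
theorem coarseSolver_of_contraction {m c : ℕ} {A : Matrix (Fin m) (Fin m) ℝ}
    {P : Matrix (Fin m) (Fin c) ℝ} {B R : Matrix (Fin c) (Fin c) ℝ} (hB : B.PosDef)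
    (hBP : B = Pᵀ * A * P) {ρ : ℝ} (hρ0 : 0 < ρ) (hρ1 : ρ < 1) (hR : EnergyBounded B R ρ) :
    ∃ D, CoarseSolver A P ((1 - R) * B⁻¹) D ∧
      ∀ b, (1 - ρ) * (b ⬝ᵥ D *ᵥ b) ≤ ρ * (b ⬝ᵥ B *ᵥ b) := by
  have hu := hR.isUnit_one_sub hB hρ1
  have hBu := hB.isUnit_det'
  have hform : ∀ y, (y - R *ᵥ y) ⬝ᵥ (B * (1 - R)⁻¹ - B) *ᵥ (y - R *ᵥ y) =
      (y - R *ᵥ y) ⬝ᵥ B *ᵥ R *ᵥ y := fun y => by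
    have h1 : (1 - R)⁻¹ *ᵥ (y - R *ᵥ y) = y := by
      rw [show y - R *ᵥ y = (1 - R) *ᵥ y by rw [Matrix.sub_mulVec, Matrix.one_mulVec],
        Matrix.mulVec_mulVec, Matrix.nonsing_inv_mul _ hu, Matrix.one_mulVec]
    rw [Matrix.sub_mulVec, ← Matrix.mulVec_mulVec, h1, ← Matrix.mulVec_sub, sub_sub_cancel]
  have hex := hR.exists_eq_sub hB hρ1
  have hinv : B * (1 - R)⁻¹ = ((1 - R) * B⁻¹)⁻¹ := by
    rw [Matrix.mul_inv_rev, Matrix.nonsing_inv_nonsing_inv _ hBu]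
  have hsymm : ((1 - R) * B⁻¹)ᵀ = (1 - R) * B⁻¹ := by
    have h1 : R * B⁻¹ = B⁻¹ * (B * R) * B⁻¹ := by
      rw [← Matrix.mul_assoc, Matrix.nonsing_inv_mul _ hBu, Matrix.one_mul]
    have h2 : B⁻¹ᵀ = B⁻¹ := hB.inv.isHermitian.transpose_eq
    rw [Matrix.sub_mul, Matrix.one_mul, Matrix.transpose_sub, h2, h1, Matrix.transpose_mul,
      Matrix.transpose_mul, hR.symm, h2]
    simp only [Matrix.mul_assoc]
  refine ⟨B * (1 - R)⁻¹ - B, ⟨?_, ?_⟩, fun b => ?_⟩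
  · refine Matrix.PosSemidef.of_dotProduct_mulVec_nonneg ?_ fun b => ?_
    · have : (B * (1 - R)⁻¹ - B)ᵀ = B * (1 - R)⁻¹ - B := by
        rw [hinv, Matrix.transpose_sub, Matrix.transpose_nonsing_inv, hsymm,
          hB.isHermitian.transpose_eq]
      simpa [Matrix.IsHermitian] using this
    · obtain ⟨y, rfl⟩ := hex b
      rw [star_trivial, hform, sub_dotProduct]
      have h1 := hR.form_sq_le hρ0 y
      have h2 := hR.nonneg y
      nlinarith
  · rw [← hBP, add_sub_cancel, hinv, Matrix.nonsing_inv_nonsing_inv]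
    rw [Matrix.det_mul]
    exact hu.mul hB.inv.isUnit_det'
  · obtain ⟨y, rfl⟩ := hex b
    rw [hform]
    exact hR.form_one_sub_le hB hρ1.le y

namespace MultigridHierarchy

variable {L : ℕ} (H : MultigridHierarchy L)

theorem smoothingLevel {k : ℕ} (hk : k < L) :
    SmoothingLevel (H.A (k + 1)) (H.M k) (H.P k) where
  posDef := H.posDef_A (k + 1) hk
  isUnit_M := (Matrix.isUnit_iff_isUnit_det _).1 (H.M_unit k hk)
  posDef_M := H.M_posDef k hk
  injective := by
    rw [Matrix.mulVec_injective_iff, linearIndependent_iff_card_eq_finrank_span,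
      Set.finrank, ← Matrix.rank_eq_finrank_span_cols, H.rank_P k hk, Fintype.card_fin]

theorem n_pos_of_le {k : ℕ} (hk : k ≤ L) : 0 < H.n k := by
  induction k with
  | zero => exact H.n_pos
  | succ k ih => exact (ih (by omega)).trans (H.n_lt k hk)

theorem eps_pos : 0 < H.eps := by
  have : Nonempty (Fin L) := ⟨⟨0, H.L_pos⟩⟩
  obtain ⟨k, hk⟩ := exists_eq_ciInf_of_finite
    (f := fun k : Fin L => lambdaMin ((H.Mtilde k)⁻¹ * H.A (k + 1)))
  rw [eps, ← hk]
  have hl := H.smoothingLevel k.2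
  have hfin := Matrix.finite_real_spectrum (A := (H.Mtilde k)⁻¹ * H.A (k + 1))
  have hne := spectrum_inv_mul_nonempty (H.n_pos_of_le k.2) hl.posDef_symmSmoother hl.symm
  exact pos_of_mem_spectrum_inv_mul hl.posDef_symmSmoother hl.posDef (hne.csInf_mem hfin)

theorem tau_pos : 0 < H.tau := by
  have hl := H.smoothingLevel H.L_pos
  have hA := H.posDef_A 0 (Nat.zero_le _)
  have hfin := Matrix.finite_real_spectrum (A := ((H.P 0)ᵀ * H.Mtilde 0 * H.P 0)⁻¹ * H.A 0)
  have hne := spectrum_inv_mul_nonempty H.n_pos hl.posDef_galerkin_symmSmoother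
    hA.isHermitian.transpose_eq
  refine (pos_of_mem_spectrum_inv_mul hl.posDef_galerkin_symmSmoother hA
    (hne.csSup_mem hfin)).trans_le ?_
  exact le_ciSup (f := fun k : Fin L =>
    lambdaMax (((H.P k)ᵀ * H.Mtilde k * H.P k)⁻¹ * H.A k)) (Set.finite_range _).bddAbove
    ⟨0, H.L_pos⟩

theorem form_le_tau {k : ℕ} (hk : k < L) (b : Fin (H.n k) → ℝ) :
    b ⬝ᵥ H.A k *ᵥ b ≤ H.tau * ((H.P k *ᵥ b) ⬝ᵥ H.Mtilde k *ᵥ H.P k *ᵥ b) := by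
  have hl := H.smoothingLevel hk
  have h1 := form_le_of_eigenvalues_le (S := H.A k) (c := H.tau) hl.posDef_galerkin_symmSmoother
    (H.posDef_A k hk.le).isHermitian.transpose_eq (fun l v hv h => ?_) b
  · rwa [← Matrix.mulVec_mulVec, ← Matrix.mulVec_mulVec, dotProduct_mulVec_transpose] at h1
  · refine (le_csSup Matrix.finite_real_spectrum.bddAbove
      (mem_spectrum_inv_mul hl.posDef_galerkin_symmSmoother.isUnit_det' hv h)).trans ?_
    exact le_ciSup (f := fun k : Fin L =>
      lambdaMax (((H.P k)ᵀ * H.Mtilde k * H.P k)⁻¹ * H.A k)) (Set.finite_range _).bddAbove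
      ⟨k, hk⟩

theorem eps_le_form {k : ℕ} (hk : k < L) (u : Fin (H.n (k + 1)) → ℝ) :
    H.eps * (u ⬝ᵥ H.A (k + 1) *ᵥ u) ≤
      u ⬝ᵥ H.A (k + 1) *ᵥ ((symmSmoother (H.A (k + 1)) (H.M k))⁻¹ * H.A (k + 1)) *ᵥ u := by
  have hl := H.smoothingLevel hk
  set N := symmSmoother (H.A (k + 1)) (H.M k) with hN
  have hNu := hl.posDef_symmSmoother.isUnit_det'
  rw [Matrix.mulVec_mulVec]
  refine le_form_of_le_eigenvalues hl.posDef ?_ (fun l v hv h => ?_) u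
  · rw [Matrix.transpose_mul, Matrix.transpose_mul, hl.symm,
      hl.posDef_symmSmoother.inv.isHermitian.transpose_eq, Matrix.mul_assoc]
  · have h1 : H.A (k + 1) *ᵥ v = l • N *ᵥ v := by
      have h2 := congrArg (fun w => N *ᵥ (H.A (k + 1))⁻¹ *ᵥ w) h
      simp only [Matrix.mulVec_smul, Matrix.mulVec_mulVec] at h2
      rwa [← Matrix.mul_assoc (H.A (k + 1))⁻¹, Matrix.nonsing_inv_mul _ hl.posDef.isUnit_det',
        Matrix.one_mul, Matrix.mul_one, ← Matrix.mul_assoc, Matrix.mul_nonsing_inv _ hNu,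
        Matrix.one_mul] at h2
    refine le_trans ?_ (csInf_le Matrix.finite_real_spectrum.bddBelow
      (mem_spectrum_inv_mul hNu hv h1))
    exact ciInf_le (f := fun k : Fin L => lambdaMin ((H.Mtilde k)⁻¹ * H.A (k + 1)))
      (Set.finite_range _).bddBelow ⟨k, hk⟩

theorem errorTG_bounded (hσ : 0 < H.sigma) {k : ℕ} (hk : k < L) :
    EnergyBounded (H.A (k + 1)) (twoGridError (H.A (k + 1)) (H.M k) (H.P k)
      ((H.P k)ᵀ * H.A (k + 1) * H.P k)⁻¹) H.sigma := by
  have hl := H.smoothingLevel hk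
  refine (hl.twoGridError_bounded (SmoothingLevel.coarseSolver_exact _ _)).of_energyOpNorm_le
    hl.posDef one_pos hσ ?_
  rw [← H.A_galerkin k hk]
  exact le_ciSup (f := fun k : Fin L => H.sigmaTG k) (Set.finite_range _).bddAbove ⟨k, hk⟩

/-- A root of the fixed-point equation is a bound on all levels: the coarse condition gives it on
level `1`, and each coarser bound `x` yields the bound `mgBound x = x` on the next level. -/
theorem errorIMG_bounded (hσ : 0 < H.sigma) (hσε : H.sigma < 1 - H.eps) {γ : ℕ}
    (hγ : γ = 1 ∨ γ = 2) {x : ℝ} (hx : IsMGRoot H.sigma H.tau H.eps γ x)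
    (hc : H.CoarseCondition x) {k : ℕ} (hk : k < L) :
    EnergyBounded (H.A (k + 1)) (H.errorIMG γ k) x := by
  have hε := H.eps_pos
  have hτ := H.tau_pos
  have hx0 := hσ.trans hx.1.1
  have hx1 : x < 1 := by linarith [hx.1.2]
  have h1σ : 0 < 1 - H.sigma := by linarith
  induction k with
  | zero =>
    have hl := H.smoothingLevel hk
    have hC : CoarseSolver (H.A 1) (H.P 0) H.Ahat⁻¹ (H.Ahat - H.A 0) := by
      refine ⟨H.Ahat_sub, ?_⟩
      rw [← H.A_galerkin 0 hk, add_sub_cancel]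
    have hden : 0 < 1 - H.eps - x := by linarith [hx.1.2]
    have hnum : 0 < x - H.sigma := by linarith [hx.1.1]
    refine hl.twoGridError_le hC (δ := H.eps * (x - H.sigma) / ((1 - H.sigma) * (1 - H.eps - x)))
      hε hσ hσε (H.errorTG_bounded hσ hk) (H.eps_le_form hk) (by positivity) (fun b => ?_) ?_
    · have h1 := form_le_of_eigenvalues_le (S := H.Ahat - H.A 0)
        (c := H.eps * (x - H.sigma) / ((1 - H.sigma) * (1 - H.eps - x)))
        hl.posDef_galerkin_symmSmoother H.Ahat_sub.isHermitian.transpose_eq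
        (fun l v hv h => (hc (mem_spectrum_inv_mul
          hl.posDef_galerkin_symmSmoother.isUnit_det' hv h)).2) b
      rwa [← Matrix.mulVec_mulVec b, ← Matrix.mulVec_mulVec, dotProduct_mulVec_transpose] at h1
    · rw [div_le_iff₀ (by positivity)]
      apply le_of_eq
      field_simp
      ring
  | succ k ih =>
    have hk' : k < L := by omega
    have hl := H.smoothingLevel hk
    have hA := H.posDef_A (k + 1) hk'
    have hρ1 : x ^ γ < 1 := pow_lt_one₀ hx0.le hx1 (by omega)
    have hρ0 : 0 < x ^ γ := pow_pos hx0 γ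
    have h1ρ : 0 < 1 - x ^ γ := by linarith
    obtain ⟨D, hC, hD⟩ := coarseSolver_of_contraction hA (H.A_galerkin (k + 1) hk) hρ0 hρ1
      ((ih hk').pow hA hx0 hγ)
    refine hl.twoGridError_le hC (δ := H.tau * x ^ γ / (1 - x ^ γ)) hε hσ hσε
      (H.errorTG_bounded hσ hk) (H.eps_le_form hk) (by positivity) (fun b => ?_) ?_
    · rw [div_mul_eq_mul_div, le_div_iff₀ h1ρ]
      have h1 := mul_le_mul_of_nonneg_left (H.form_le_tau hk b) hρ0.le
      have h2 := hD b
      rw [Mtilde] at h1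
      linarith
    · have hroot := sub_eq_zero.1 hx.2
      have hden := mgBound_den_pos hε hσε hτ γ hx0 hx1
      rw [mgBound, div_eq_iff hden.ne'] at hroot
      rw [div_le_iff₀ (by positivity)]
      apply le_of_eq
      field_simp
      linarith

theorem sigmaIMG_le (hσ : 0 < H.sigma) (hσε : H.sigma < 1 - H.eps) {γ : ℕ}
    (hγ : γ = 1 ∨ γ = 2) {x : ℝ} (hx : IsMGRoot H.sigma H.tau H.eps γ x)
    (hc : H.CoarseCondition x) {k : ℕ} (hk : k < L) : H.sigmaIMG γ k ≤ x :=
  (H.errorIMG_bounded hσ hσε hγ hx hc hk).energyOpNorm_le (hσ.trans hx.1.1)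

end MultigridHierarchy

theorem corollary4p3 {L : ℕ} (H : MultigridHierarchy L)
    (hσ_pos : 0 < H.sigma) (hσ_lt : H.sigma < 1 - H.eps) :
    (∀ x : ℝ, IsMGRoot H.sigma H.tau H.eps 1 x ↔ x = xOne H.sigma H.tau H.eps) ∧
    (∀ x : ℝ, IsMGRoot H.sigma H.tau H.eps 1 x → H.CoarseCondition x →
      ∀ k < L, H.sigmaIMG 1 k ≤ xOne H.sigma H.tau H.eps) ∧
    (∀ x : ℝ, IsMGRoot H.sigma H.tau H.eps 2 x → H.CoarseCondition x →
      ∀ k < L, H.sigmaIMG 2 k ≤ xHatTwo H.sigma H.tau H.eps) := by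
  have h1 := isMGRoot_one_iff H.eps_pos hσ_pos hσ_lt H.tau_pos
  refine ⟨h1, fun x hx hc k hk => ?_, fun x hx hc k hk => ?_⟩
  · rw [← (h1 x).1 hx]
    exact H.sigmaIMG_le hσ_pos hσ_lt (Or.inl rfl) hx hc hk
  · exact (H.sigmaIMG_le hσ_pos hσ_lt (Or.inr rfl) hx hc hk).trans
      (le_xHatTwo H.eps_pos hσ_pos hσ_lt H.tau_pos hx)
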